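/- **Definitions.** For an infinite cardinal $\kappa$ let $\mathrm{reg}(\kappa)=\kappa^+$ if $\kappa$ is singular and $\mathrm{reg}(\kappa)=\kappa$ otherwise. For cardinals $\mu,\kappa$ and a set $A$, let $\mathcal M_{\mu,\kappa}(A)$ be the free algebra generated by $A$ in the vocabulary $\{F_{\alpha,\beta}:\alpha<\mu,\ \beta<\kappa\}$, where $F_{\alpha,\beta}$ is a $\beta$-ary function symbol (so infinite arities are allowed): it is the smallest set that contains $A$ and is closed under forming the formal objects $F_{\alpha,\beta}(\bar b)$ from $\beta$-tuples $\bar b$. Terms in a set $X$ of variables are the elements of $\mathcal M_{\mu,\kappa}(X)$. For a permutation $\pi$ of $A$, $\widehat\pi$ denotes the induced automorphism of $\mathcal M_{\mu,\kappa}(A)$. Let $M$ be a first-order structure. A *skeletal homogeneous representation* of $M$ in $\mathcal M_{\mu,\kappa}(A)$ is an injective function $\Phi:D\to\mathcal M_{\mu,\kappa}(A)$ with $D\subseteq M$ such that (i) for every term $t(\bar x)$, where $\bar x$ is a tuple of variables of length $\beta<\mathrm{reg}(\kappa)$ containing the variables of $t$, if $t(\bar a)\in\mathrm{Im}(\Phi)$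 for some injective $\bar a:\beta\to A$, then $t(\bar b)\in\mathrm{Im}(\Phi)$ for all injective $\bar b:\beta\to A$; (ii) for all $n$ and all $n$-tuples $\bar a,\bar b$ of distinct elements of $D$, if there is a permutation $\pi$ of $A$ with $\widehat\pi(\Phi(a_i))=\Phi(b_i)$ for all $i<n$, then $\mathrm{tp}^M(\bar a)=\mathrm{tp}^M(\bar b)$; (iii) $\mathrm{dcl}(D)=M$. The chromatic number $\chi(G)$ of a graph $G$ is the least cardinality of a set of colors of a proper vertex coloring of $G$. A graph $G=(V,E)$ is *$\emptyset$-interpretable* in $M$ if for some $r\in\mathbb N$ there are an $\emptyset$-definable set $V_0\subseteq M^r$ and a surjection $g:V_0\to V$ such that $\{(x,y)\in V_0^2: g(x)=g(y)\}$ and $\{(x,y)\in V_0^2: g(x)\mathrel{E}g(y)\}$ are $\emptyset$-definable. For $n\ge 1$, the shift graph $\mathrm{Sh}_n(\omega)$ has as vertices the strictly increasing $n$-tuples of natural numbers, and distinct $s,t$ are adjacent iff $s(i)=t(i-1)$ for all $1\le i\le n-1$, or vice versa. **Proposition.** Let $M$ be a structure in a first-order language $L$, let $A$ be a set, let $\mu,\kappa$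 be infinite cardinals and let $\varkappa$ be a regular cardinal with $|L|<\varkappa$. Assume that there is a skeletal homogeneous representation of $M$ in $\mathcal M_{\mu,\kappa}(A)$ and that 1. $(\mathrm{reg}(\kappa)+\mu)^{<\mathrm{reg}(\kappa)}<\varkappa$, 2. $2^{2^{\lambda}}<\varkappa$ for all cardinals $\lambda<\mathrm{reg}(\kappa)$, 3. $2^{<\mathrm{reg}(\kappa)}\le|A|$. Then for every graph $G$ that is $\emptyset$-interpretable in $M$ and satisfies $\chi(G)\ge\varkappa$ there is a natural number $n\ge1$ such that $G$ contains all finite subgraphs of $\mathrm{Sh}_n(\omega)$, i.e. every finite subgraph of $\mathrm{Sh}_n(\omega)$ admits an injective graph homomorphism into $G$. -/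

import Mathlib

open Cardinal

universe u v u₁ u₂

noncomputable section

namespace ShiftRep

/-! ### Graphs -/

/-- The shift graph `Sh_n(α)`: vertices are strictly increasing `n`-tuples of elements of `α`, and
`s`, `t` are adjacent iff `s (i + 1) = t i` for all `i + 1 < n`, or vice versa. The requirement
`s ≠ t` only matters for `n ≤ 1`; for `n = 1` the graph is the complete graph on `α`. -/
def shiftGraph (n : ℕ) (α : Type u) [LinearOrder α] : SimpleGraph (Fin n ↪o α) where
  Adj s t := s ≠ t ∧
    ((∀ (i : ℕ) (h : i + 1 < n), s ⟨i + 1, h⟩ = t ⟨i, Nat.lt_of_succ_lt h⟩) ∨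
     (∀ (i : ℕ) (h : i + 1 < n), t ⟨i + 1, h⟩ = s ⟨i, Nat.lt_of_succ_lt h⟩))
  symm := ⟨fun _ _ h => ⟨h.1.symm, h.2.symm⟩⟩
  loopless := ⟨fun _ h => h.1 rfl⟩

/-- Every finite (not necessarily induced) subgraph of `H` embeds into `G` as a subgraph. -/
def ContainsFiniteSubgraphs {W : Type v} {V : Type u} (H : SimpleGraph W) (G : SimpleGraph V) :
    Prop :=
  ∀ S : H.Subgraph, S.verts.Finite → S.coe.IsContained G

/-- The chromatic number of a graph, as a (possibly infinite) cardinal: the least cardinality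
of a set of colors of a proper vertex coloring. -/
def chromaticCard {V : Type u} (G : SimpleGraph V) : Cardinal.{u} :=
  sInf {c : Cardinal.{u} | ∃ C : Type u, #C = c ∧ Nonempty (G.Coloring C)}

/-! ### Cardinals -/

open Classical in
/-- `reg κ` is `κ⁺` if `κ` is singular (infinite and not regular), and `κ` otherwise. -/
def reg (κ : Cardinal.{u}) : Cardinal.{u} :=
  if ℵ₀ ≤ κ ∧ ¬ κ.IsRegular then Order.succ κ else κ

/-! ### The free algebra -/

/-- The free algebra `𝓜_{μ,κ}(A)` over the set `A`, with function symbols `F_{α,β}` for `α < μ`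
and `β < κ`, where `F_{α,β}` is `β`-ary. An ordinal `β < κ` is an element of `κ.ord.ToType`, and
`β`-tuples are functions on its set `Set.Iio β` of predecessors, which has order type `β`. -/
inductive FreeAlg (μ κ : Cardinal.{u}) (A : Type u) : Type u
  | of : A → FreeAlg μ κ A
  | app (α : μ.ord.ToType) (β : κ.ord.ToType) (b : Set.Iio β → FreeAlg μ κ A) : FreeAlg μ κ A

/-- The homomorphism of free algebras induced by a map of generators. If `π` is a permutation of
`A` then `FreeAlg.map π` is the induced automorphism of the free algebra. An element `t` of
`FreeAlg μ κ X` is a term in the variables `X`, and for `a : X → A` the value `t(a)` of the term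
at `a` is `FreeAlg.map a t`. -/
def FreeAlg.map {μ κ : Cardinal.{u}} {X A : Type u} (a : X → A) : FreeAlg μ κ X → FreeAlg μ κ A
  | .of x => .of (a x)
  | .app α β b => .app α β fun i => FreeAlg.map a (b i)

/-! ### Model theory -/

section ModelTheory

variable (L : FirstOrder.Language.{u₁, u₂}) {M : Type u} [L.Structure M]

/-- Two tuples of `M` have the same complete type over `∅`. -/
def SameType {ι : Type} (a b : ι → M) : Prop :=
  ∀ φ : L.Formula ι, φ.Realize a ↔ φ.Realize b

/-- The definable closure of a subset of `M`. -/
def dcl (X : Set M) : Set M :=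
  {m | X.Definable₁ L {m}}

/-- `Φ : D → 𝓜_{μ,κ}(A)`, viewed as a partial function on `M` with domain `D`, is a skeletal
homogeneous representation of `M`. -/
structure IsSkeletalHomRep {μ κ : Cardinal.{u}} {A : Type u} (D : Set M)
    (Φ : D → FreeAlg μ κ A) : Prop where
  injective : Function.Injective Φ
  /-- For every term `t(x̄)`, with `x̄` a tuple of variables of length `β < reg κ`, if `t(ā)` is in
  the image for some injective `ā : β → A` then `t(b̄)` is in the image for all injective
  `b̄ : β → A`. -/
  image_homogeneous : ∀ (β : (reg κ).ord.ToType) (t : FreeAlg μ κ (Set.Iio β))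
    (a b : Set.Iio β → A), Function.Injective a → Function.Injective b →
    FreeAlg.map a t ∈ Set.range Φ → FreeAlg.map b t ∈ Set.range Φ
  /-- Finite injective tuples of the domain whose images are conjugate by the automorphism induced
  by a permutation of `A` have the same type in `M`. -/
  type_homogeneous : ∀ (n : ℕ) (a b : Fin n → D), Function.Injective a → Function.Injective b →
    (∃ π : Equiv.Perm A, ∀ i, FreeAlg.map π (Φ (a i)) = Φ (b i)) →
    SameType L (fun i => (a i : M)) (fun i => (b i : M))
  dcl_eq : dcl L D = Set.univ

variable (M)

/-- The graph `G` is `∅`-interpretable in `M`: for some `r` there are an `∅`-definable set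
`V₀ ⊆ M ^ r` and a surjection `g : V₀ → V` such that the preimages under `g` of equality and of
the edge relation are `∅`-definable. -/
def IsInterpretable {V : Type u} (G : SimpleGraph V) : Prop :=
  ∃ (r : ℕ) (V₀ : Set (Fin r → M)) (g : V₀ → V),
    (∅ : Set M).Definable L V₀ ∧
    Function.Surjective g ∧
    (∅ : Set M).Definable L
      {p : Fin r ⊕ Fin r → M | ∃ x y : V₀, p = Sum.elim x.1 y.1 ∧ g x = g y} ∧
    (∅ : Set M).Definable L
      {p : Fin r ⊕ Fin r → M | ∃ x y : V₀, p = Sum.elim x.1 y.1 ∧ G.Adj (g x) (g y)}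

end ModelTheory

end ShiftRep

end

namespace ShiftRep

/-! ### Maps determined by equality patterns -/

section Patterns

variable {A : Type*} {B : Type*} {V : Type*}

/-- The equality pattern of a pair of injective tuples. -/
def pattern (a b : B ↪ A) (i j : B) : Prop := a i = b j

/-- The relation `R`, pulled back along `v`, only depends on the equality pattern of its
arguments. -/
def PatternInvariant (v : (B ↪ A) → V) (R : V → V → Prop) : Prop :=
  ∀ a b a' b' : B ↪ A, pattern a b = pattern a' b' → R (v a) (v b) → R (v a') (v b')

/-- There is a map from injective `k`-tuples of natural numbers to `G` whose kernel only depends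
on equality patterns and which sends pairs with the equality pattern of a shift to edges. -/
def HasShiftMap (G : SimpleGraph V) (k : ℕ) : Prop :=
  ∃ v : (Fin k ↪ ℕ) → V, PatternInvariant v Eq ∧
    ∀ s t : Fin k ↪ ℕ, (∀ i j, t i = s j ↔ j.val = i.val + 1) → G.Adj (v s) (v t)

theorem pattern_trans {C : Type*} (e : A ↪ C) (a b : B ↪ A) :
    pattern (a.trans e) (b.trans e) = pattern a b := by
  funext i j
  simp [pattern]

theorem PatternInvariant.range_subset {k : ℕ} {v : (Fin k ↪ ℕ) → V} (hv : PatternInvariant v Eq)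
    (hdep : ∀ (j : Fin k) (s t : Fin k ↪ ℕ), s j ≠ t j → (∀ i ≠ j, s i = t i) → v s ≠ v t)
    {s t : Fin k ↪ ℕ} (hst : v s = v t) : Set.range s ⊆ Set.range t := by
  rintro _ ⟨i, rfl⟩
  by_contra hi
  obtain ⟨x, hx⟩ := Set.Infinite.exists_notMem_finset Set.infinite_univ
    (Finset.univ.image s ∪ Finset.univ.image t)
  have hxs : ∀ c, s c ≠ x := fun c h => hx.2 (by simp [← h])
  have hxt : ∀ c, t c ≠ x := fun c h => hx.2 (by simp [← h])
  have hit : ∀ c, t c ≠ s i := fun c h => hi ⟨c, h⟩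
  let s' : Fin k ↪ ℕ := s.trans (Equiv.swap (s i) x).toEmbedding
  have hs'i : s' i = x := by simp [s']
  have hs'c : ∀ c ≠ i, s c = s' c := fun c hc =>
    (Equiv.swap_apply_of_ne_of_ne (s.injective.ne hc) (hxs c)).symm
  refine hdep i s s' (by rw [hs'i]; exact hxs i) hs'c (hst.trans ?_)
  refine (hv s t s' t ?_ hst).symm
  funext c d
  by_cases hc : c = i
  · subst hc
    simp [pattern, hs'i, (hxt d).symm, (hit d).symm]
  · simp [pattern, hs'c c hc]

theorem shift_pattern_of_adj {k : ℕ} {s t : Fin k ↪o ℕ} (hne : s ≠ t)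
    (h : ∀ (i : ℕ) (h : i + 1 < k), s ⟨i + 1, h⟩ = t ⟨i, Nat.lt_of_succ_lt h⟩) (i j : Fin k) :
    t i = s j ↔ j.val = i.val + 1 := by
  constructor
  · intro hij
    by_cases hi : i.val + 1 < k
    · rw [← h i hi] at hij
      rw [← s.injective hij]
    · exfalso
      rcases Nat.eq_zero_or_pos i.val with h0 | h0
      · apply hne
        have hk : k = 1 := by omega
        subst hk
        ext c
        rw [Subsingleton.elim c j, ← hij, Subsingleton.elim i j]
      · have h1 : i.val - 1 + 1 < k := by omega
        have h2 := h (i.val - 1) h1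
        have h3 : t ⟨i.val - 1, Nat.lt_of_succ_lt h1⟩ < t i := by
          apply t.strictMono
          rw [Fin.lt_def]
          simp only
          omega
        have h4 : s j ≤ s ⟨i.val - 1 + 1, h1⟩ := by
          apply s.monotone
          rw [Fin.le_def]
          simp only
          omega
        omega
  · intro hij
    have hj : j = ⟨i.val + 1, hij ▸ j.isLt⟩ := Fin.ext hij
    rw [hj, h]

theorem PatternInvariant.exists_injective_hom {G : SimpleGraph V} {k : ℕ} {v : (Fin k ↪ ℕ) → V}
    (hv : PatternInvariant v Eq)
    (hadj : ∀ s t : Fin k ↪ ℕ, (∀ i j, t i = s j ↔ j.val = i.val + 1) → G.Adj (v s) (v t))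
    (hdep : ∀ (j : Fin k) (s t : Fin k ↪ ℕ), s j ≠ t j → (∀ i ≠ j, s i = t i) → v s ≠ v t) :
    ∃ f : shiftGraph k ℕ →g G, Function.Injective f := by
  refine ⟨⟨fun s => v s.toEmbedding, ?_⟩, ?_⟩
  · rintro s t ⟨hne, h | h⟩
    · exact hadj _ _ (shift_pattern_of_adj hne h)
    · exact (hadj _ _ (shift_pattern_of_adj hne.symm h)).symm
  · intro s t hst
    have h : Set.range s = Set.range t :=
      (hv.range_subset hdep hst).antisymm (hv.range_subset hdep hst.symm)
    exact DFunLike.coe_injective ((s.strictMono.range_inj t.strictMono).1 h)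

/-- Insert the entry `y` at position `j` into the concatenation of (initial segments of) two
disjoint copies of the tuple `s`, the first of length `j`. -/
def insertBetween {k : ℕ} (j : Fin (k + 1)) (s : Fin k → ℕ) (y : ℕ) (c : Fin (k + 1)) : ℕ :=
  if h₁ : c < j then Nat.pair 0 (s ⟨c, by omega⟩)
  else if h₂ : j < c then Nat.pair 1 (s ⟨c - j - 1, by omega⟩)
  else y

theorem insertBetween_injective {k : ℕ} (j : Fin (k + 1)) {s : Fin k → ℕ}
    (hs : Function.Injective s) {y : ℕ} (h₀ : ∀ i : Fin k, i.val < j → y ≠ Nat.pair 0 (s i))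
    (h₁ : ∀ i : Fin k, i.val + j < k → y ≠ Nat.pair 1 (s i)) :
    Function.Injective (insertBetween j s y) := by
  intro c d hcd
  have key : ∀ i i' : Fin k, s i = s i' → i.val = i'.val := fun i i' h => congrArg _ (hs h)
  unfold insertBetween at hcd
  split_ifs at hcd with c1 d1 d2 c2 d1 d2 d1 d2
  all_goals first
    | (rw [Nat.pair_eq_pair] at hcd
       have := key _ _ hcd.2
       simp only at this
       omega)
    | exact absurd hcd (h₀ _ (by simpa using d1))
    | exact absurd hcd.symm (h₀ _ (by simpa using c1))
    | exact absurd hcd (h₁ _ (by simp only; omega))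
    | exact absurd hcd.symm (h₁ _ (by simp only; omega))
    | omega

/-- If one coordinate never matters then the tuples can be shortened. -/
theorem HasShiftMap.of_irrelevant {G : SimpleGraph V} {k : ℕ} {v : (Fin (k + 1) ↪ ℕ) → V}
    (hv : PatternInvariant v Eq)
    (hadj : ∀ s t : Fin (k + 1) ↪ ℕ, (∀ i j, t i = s j ↔ j.val = i.val + 1) → G.Adj (v s) (v t))
    {j : Fin (k + 1)} {s₀ t₀ : Fin (k + 1) ↪ ℕ} (hj : s₀ j ≠ t₀ j) (hne : ∀ i ≠ j, s₀ i = t₀ i)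
    (h₀ : v s₀ = v t₀) : HasShiftMap G k := by
  have irrel : ∀ s t : Fin (k + 1) ↪ ℕ, (∀ i ≠ j, s i = t i) → v s = v t := by
    have pat : ∀ s t : Fin (k + 1) ↪ ℕ, s j ≠ t j → (∀ i ≠ j, s i = t i) →
        ∀ c d, pattern s t c d ↔ c = d ∧ c ≠ j := by
      intro s t h h' c d
      unfold pattern
      constructor
      · intro hcd
        by_cases hd : d = j
        · subst hd
          by_cases hc : c = d
          · subst hc; exact absurd hcd h
          · rw [h' c hc] at hcd
            exact absurd (t.injective hcd) hc
        · rw [← h' d hd] at hcd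
          have := s.injective hcd
          subst this
          exact ⟨rfl, hd⟩
      · rintro ⟨rfl, hc⟩
        exact h' c hc
    intro s t h
    by_cases hst : s j = t j
    · congr 1
      ext c
      by_cases hc : c = j
      · rw [hc, hst]
      · exact h c hc
    · refine hv s₀ t₀ s t ?_ h₀
      funext c d
      rw [pat s₀ t₀ hj hne c d, pat s t hst h c d]
  have fresh : ∀ (s : Fin k ↪ ℕ) (n : ℕ),
      Function.Injective (insertBetween j s (Nat.pair 2 n)) := fun s n =>
    insertBetween_injective j s.injective (fun i _ => by simp [Nat.pair_eq_pair])
      (fun i _ => by simp [Nat.pair_eq_pair])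
  refine ⟨fun s => v ⟨_, fresh s 0⟩, ?_, ?_⟩
  · intro s t s' t' hp
    apply hv
    funext c d
    have hp' : ∀ i i', s i = t i' ↔ s' i = t' i' := fun i i' => iff_of_eq (congrFun₂ hp i i')
    simp only [pattern, Function.Embedding.coeFn_mk, insertBetween]
    split_ifs <;> simp [Nat.pair_eq_pair, hp']
  · intro s t hst
    let y : ℕ := if h : 0 < j.val then Nat.pair 0 (t ⟨j - 1, by omega⟩) else Nat.pair 2 0
    let z : ℕ := if h : j.val < k then Nat.pair 1 (s ⟨0, by omega⟩) else Nat.pair 2 1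
    have hy : Function.Injective (insertBetween j s y) := by
      refine insertBetween_injective j s.injective ?_ ?_
      · intro i hi
        simp only [y]
        split_ifs with h
        · simp only [ne_eq, Nat.pair_eq_pair, hst, true_and]
          omega
        · simp [Nat.pair_eq_pair]
      · intro i hi
        simp only [y]
        split_ifs <;> simp [Nat.pair_eq_pair]
    have hz : Function.Injective (insertBetween j t z) := by
      refine insertBetween_injective j t.injective ?_ ?_
      · intro i hi
        simp only [z]
        split_ifs <;> simp [Nat.pair_eq_pair]
      · intro i hi
        simp only [z]
        split_ifs with h
        · simp only [ne_eq, Nat.pair_eq_pair, @eq_comm _ (s _), hst, true_and]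
          omega
        · simp [Nat.pair_eq_pair]
    have ey : v ⟨_, fresh s 0⟩ = v ⟨_, hy⟩ := by
      apply irrel
      intro i hi
      have : i.val ≠ j.val := fun h => hi (Fin.ext h)
      simp only [Function.Embedding.coeFn_mk, insertBetween]
      split_ifs <;> first | rfl | omega
    have ez : v ⟨_, fresh t 0⟩ = v ⟨_, hz⟩ := by
      apply irrel
      intro i hi
      have : i.val ≠ j.val := fun h => hi (Fin.ext h)
      simp only [Function.Embedding.coeFn_mk, insertBetween]
      split_ifs <;> first | rfl | omega
    beta_reduce
    rw [ey, ez]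
    apply hadj
    intro c d
    simp only [Function.Embedding.coeFn_mk, insertBetween, y, z]
    split_ifs <;>
      simp only [Nat.pair_eq_pair, hst, Fin.lt_def, true_and, EmbeddingLike.apply_eq_iff_eq,
        Fin.mk.injEq, zero_ne_one, one_ne_zero, false_and, false_iff, OfNat.ofNat_ne_zero,
        OfNat.zero_ne_ofNat, OfNat.ofNat_ne_one, OfNat.one_ne_ofNat] at * <;>
      omega

theorem HasShiftMap.exists_injective_hom {G : SimpleGraph V} {k : ℕ} (h : HasShiftMap G k) :
    ∃ n : ℕ, 1 ≤ n ∧ ∃ f : shiftGraph n ℕ →g G, Function.Injective f := by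
  induction k with
  | zero =>
    obtain ⟨v, -, hadj⟩ := h
    let s : Fin 0 ↪ ℕ := ⟨fun i => i.elim0, fun i => i.elim0⟩
    exact absurd (hadj s s fun i => i.elim0) (G.loopless.irrefl _)
  | succ k ih =>
    obtain ⟨v, hv, hadj⟩ := h
    by_cases hdep : ∀ (j : Fin (k + 1)) (s t : Fin (k + 1) ↪ ℕ), s j ≠ t j →
        (∀ i ≠ j, s i = t i) → v s ≠ v t
    · exact ⟨k + 1, by omega, hv.exists_injective_hom hadj hdep⟩
    · push Not at hdep
      obtain ⟨j, s, t, hj, hne, hst⟩ := hdep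
      exact ih (.of_irrelevant hv hadj hj hne hst)

/-- A relation is long if it has arbitrarily long finite walks without stationary steps. -/
def IsLong (p : B → B → Prop) : Prop :=
  ∀ m : ℕ, ∃ w : ℕ → B, ∀ j < m, p (w j) (w (j + 1)) ∧ w j ≠ w (j + 1)

/-- Pairs of tuples whose equality pattern is long form a countably chromatic graph. The colour of
a tuple locates it in its class for the equality of tails of (germs of) the sequences which it
induces along longer and longer walks. -/
theorem IsLong.exists_coloring {p : B → B → Prop} (hp : IsLong p) :
    ∃ c : (B ↪ A) → ℕ × ℕ, ∀ a b, pattern a b = p → c a ≠ c b := by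
  choose w hw using hp
  let r : (B ↪ A) → (B ↪ A) → ℕ × ℕ → Prop := fun a b k =>
    ∀ n, ∀ᶠ m in Filter.atTop, a (w m (n + k.1)) = b (w m (n + k.2))
  let S : Setoid (B ↪ A) :=
    { r := fun a b => ∃ k, r a b k
      iseqv :=
        { refl := fun a => ⟨(0, 0), fun n => .of_forall fun m => rfl⟩
          symm := fun ⟨k, hk⟩ => ⟨(k.2, k.1), fun n => (hk n).mono fun m h => h.symm⟩
          trans := by
            rintro a b c ⟨k, hk⟩ ⟨l, hl⟩
            refine ⟨(k.1 + l.1, k.2 + l.2), fun n => ?_⟩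
            filter_upwards [hk (n + l.1), hl (n + k.2)] with m h₁ h₂
            rw [show n + l.1 + k.1 = n + (k.1 + l.1) by ring] at h₁
            rw [show n + k.2 + l.1 = n + l.1 + k.2 by ring,
              show n + k.2 + l.2 = n + (k.2 + l.2) by ring] at h₂
            exact h₁.trans h₂ } }
  have hrep : ∀ a : B ↪ A, ∃ k, r a (Quotient.out (Quotient.mk S a)) k := fun a =>
    S.symm (Quotient.mk_out (s := S) a)
  choose c hc using hrep
  refine ⟨c, fun a b hab hcol => ?_⟩
  have step : ∀ m j, j < m → a (w m j) = b (w m (j + 1)) := by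
    intro m j hj
    have := (hw m j hj).1
    rwa [← hab] at this
  have hS : Quotient.mk S a = Quotient.mk S b := by
    refine Quotient.sound ⟨(0, 1), fun n => ?_⟩
    filter_upwards [Filter.eventually_gt_atTop n] with m hm
    exact step m n hm
  have ha := hc a 0
  have hb := hc b 0
  rw [← hS, ← hcol] at hb
  obtain ⟨m, h₁, h₂, hm⟩ :=
    (ha.and (hb.and (Filter.eventually_gt_atTop (0 + (c a).1)))).exists
  have h₃ := step m _ hm
  rw [h₁, ← h₂] at h₃
  exact (hw m _ hm).2 (b.injective h₃)

/-- A short partial injection splits into stationary points and chains of bounded length: `root`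
and `pos` tell the chain of a point and its position there. -/
theorem exists_root_pos {p : B → B → Prop} (hr : ∀ i j j', p i j → p i j' → j = j')
    (hl : ∀ i i' j, p i j → p i' j → i = i') (hp : ¬ IsLong p) :
    ∃ (k : ℕ) (root : B → B) (pos : B → ℕ), (∀ i, pos i < k) ∧
      (∀ i j, root i = root j → pos i = pos j → i = j) ∧
      (∀ i j, ¬ p i i → (p i j ↔ root i = root j ∧ pos j = pos i + 1)) := by
  classical
  let pred : B → B := fun j => if h : ∃ i, i ≠ j ∧ p i j then h.choose else j
  have hpred : ∀ j, pred j ≠ j → p (pred j) j := by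
    intro j hj
    by_cases h : ∃ i, i ≠ j ∧ p i j
    · have : pred j = h.choose := dif_pos h
      rw [this]
      exact h.choose_spec.2
    · exact absurd (dif_neg h) hj
  have hpred' : ∀ i j, p i j → i ≠ j → pred j = i := by
    intro i j hij hne
    have h : ∃ i, i ≠ j ∧ p i j := ⟨i, hne, hij⟩
    have : pred j = h.choose := dif_pos h
    rw [this]
    exact hl _ _ _ h.choose_spec.2 hij
  obtain ⟨m, hm⟩ := not_forall.1 hp
  have hterm : ∀ i, ∃ n, n < m ∧ pred (pred^[n] i) = pred^[n] i := by
    intro i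
    by_contra! hcon
    refine hm ⟨fun j => pred^[m - j] i, fun j hj => ?_⟩
    have hj' : m - j = (m - (j + 1)) + 1 := by omega
    have := hcon (m - (j + 1)) (by omega)
    simp only [hj', Function.iterate_succ_apply']
    exact ⟨hpred _ this, this⟩
  have hterm' : ∀ i, ∃ n, pred (pred^[n] i) = pred^[n] i := fun i =>
    (hterm i).imp fun n h => h.2
  let pos : B → ℕ := fun i => Nat.find (hterm' i)
  let root : B → B := fun i => pred^[pos i] i
  have pos_zero : ∀ i, pos i = 0 → pred i = i := fun i h => (Nat.find_eq_zero (hterm' i)).1 h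
  have pos_succ : ∀ i, pred i ≠ i → pos i = pos (pred i) + 1 := fun i h =>
    Nat.find_comp_succ (hterm' i) (hterm' (pred i)) h
  have root_succ : ∀ i, pred i ≠ i → root i = root (pred i) := by
    intro i h
    simp only [root]
    rw [pos_succ i h]
    rfl
  have root_zero : ∀ i, pos i = 0 → root i = i := by
    intro i h
    simp only [root]
    rw [h]
    rfl
  have hinj : ∀ n i j, pos i = n → pos j = n → root i = root j → i = j := by
    intro n
    induction n with
    | zero =>
      intro i j hi hj h
      rwa [root_zero i hi, root_zero j hj] at h
    | succ n ih =>
      intro i j hi hj h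
      have hi' : pred i ≠ i := fun h' => by
        have := (Nat.find_eq_zero (hterm' i)).2 h'
        simp only [pos] at hi
        omega
      have hj' : pred j ≠ j := fun h' => by
        have := (Nat.find_eq_zero (hterm' j)).2 h'
        simp only [pos] at hj
        omega
      have e : pred i = pred j := by
        apply ih
        · have := pos_succ i hi'; omega
        · have := pos_succ j hj'; omega
        · rwa [root_succ i hi', root_succ j hj'] at h
      have h₁ := hpred i hi'
      rw [e] at h₁
      exact hr _ _ _ h₁ (hpred j hj')
  refine ⟨m, root, pos, ?_, ?_, ?_⟩
  · intro i
    obtain ⟨n, hn, h⟩ := hterm i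
    exact (Nat.find_min' (hterm' i) h).trans_lt hn
  · intro i j h h'
    exact hinj _ i j rfl h'.symm h
  · intro i j hi
    constructor
    · intro hij
      have hne : i ≠ j := fun h => hi (by subst h; exact hij)
      have e := hpred' i j hij hne
      have hj : pred j ≠ j := by rwa [e]
      rw [root_succ j hj, pos_succ j hj, e]
      exact ⟨rfl, rfl⟩
    · rintro ⟨h₁, h₂⟩
      have hj : pred j ≠ j := fun h' => by
        have := (Nat.find_eq_zero (hterm' j)).2 h'
        simp only [pos] at h₂
        omega
      have := hinj (pos i) i (pred j) rfl (by have := pos_succ j hj; omega)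
        (by rw [h₁, root_succ j hj])
      rw [this]
      exact hpred j hj

/-- An edge with a short equality pattern gives rise to a map of shift type. -/
theorem hasShiftMap_of_not_isLong {G : SimpleGraph V} {v : (B ↪ A) → V}
    (hEq : PatternInvariant v Eq) (hAdj : PatternInvariant v G.Adj) (e : B × Option ℕ ↪ A)
    {a b : B ↪ A} (hab : G.Adj (v a) (v b)) (hp : ¬ IsLong (pattern a b)) :
    ∃ k, HasShiftMap G k := by
  classical
  obtain ⟨k, root, pos, hpos, hinj, hroot⟩ := exists_root_pos (p := pattern a b)
    (fun i j j' h h' => b.injective (h.symm.trans h'))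
    (fun i i' j h h' => a.injective (h.trans h'.symm)) hp
  have hfix : ∀ i j, pattern a b i i → (pattern a b i j ↔ i = j) := fun i j h =>
    ⟨fun h' => b.injective (h.symm.trans h'), fun h' => h' ▸ h⟩
  have hfix' : ∀ i j, pattern a b j j → (pattern a b i j ↔ i = j) := fun i j h =>
    ⟨fun h' => a.injective (h'.trans h.symm), fun h' => h' ▸ h⟩
  let f₀ : (Fin k → ℕ) → B → B × Option ℕ := fun s i =>
    if pattern a b i i then (i, none) else (root i, some (s ⟨pos i, hpos i⟩))
  have hf₀ : ∀ s t i j, f₀ s i = f₀ t j ↔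
      (pattern a b i i ∧ i = j) ∨ (¬ pattern a b i i ∧ ¬ pattern a b j j ∧ root i = root j ∧
        s ⟨pos i, hpos i⟩ = t ⟨pos j, hpos j⟩) := by
    intro s t i j
    simp only [f₀]
    split_ifs with h₁ h₂ h₂
    · simp [h₁]
    · simp only [Prod.mk.injEq, reduceCtorEq, and_false, h₁, true_and, not_true, false_and,
        or_false, false_iff]
      rintro rfl
      exact h₂ h₁
    · simp [h₁, h₂]
    · simp [h₁, h₂]
  have hf₀inj : ∀ s : Fin k ↪ ℕ, Function.Injective (f₀ s) := by
    intro s i j h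
    rcases (hf₀ s s i j).1 h with h | ⟨-, -, h₁, h₂⟩
    · exact h.2
    · exact hinj i j h₁ (congrArg Fin.val (s.injective h₂))
  let f : (Fin k ↪ ℕ) → (B ↪ A) := fun s => (⟨f₀ s, hf₀inj s⟩ : B ↪ B × Option ℕ).trans e
  have hf : ∀ s t i j, pattern (f s) (f t) i j ↔ f₀ s i = f₀ t j := by
    intro s t i j
    simp only [f]
    rw [pattern_trans]
    rfl
  refine ⟨k, fun s => v (f s), ?_, ?_⟩
  · intro s t s' t' hst
    apply hEq
    funext i j
    apply propext
    have h := congrFun₂ hst ⟨pos i, hpos i⟩ ⟨pos j, hpos j⟩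
    simp only [pattern] at h
    rw [hf, hf, hf₀, hf₀, h]
  · intro s t hst
    refine (hAdj a b _ _ ?_ hab).symm
    funext i j
    apply propext
    rw [hf, hf₀, hst]
    by_cases hi : pattern a b i i
    · simp [hi, hfix i j hi]
    · by_cases hj : pattern a b j j
      · simp only [hi, hj, hfix' i j hj, false_and, not_true, and_false, or_false, iff_false]
        rintro rfl
        exact hi hj
      · simp [hi, hj, hroot i j hi]

/-- Dichotomy for graphs whose vertices are represented by injective tuples in such a way that
equality and adjacency only depend on equality patterns. -/
theorem exists_injective_hom_or_coloring {G : SimpleGraph V} {v : (B ↪ A) → V}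
    (hEq : PatternInvariant v Eq) (hAdj : PatternInvariant v G.Adj) (e : B × Option ℕ ↪ A) :
    (∃ n : ℕ, 1 ≤ n ∧ ∃ f : shiftGraph n ℕ →g G, Function.Injective f) ∨
      ∃ c : V → ((B → B → Prop) → ℕ × ℕ),
        ∀ x ∈ Set.range v, ∀ y ∈ Set.range v, G.Adj x y → c x ≠ c y := by
  classical
  by_cases h : ∀ a b, G.Adj (v a) (v b) → IsLong (pattern a b)
  · right
    have hcol : ∀ p : B → B → Prop, ∃ c : (B ↪ A) → ℕ × ℕ,
        IsLong p → ∀ a b, pattern a b = p → c a ≠ c b := by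
      intro p
      by_cases hp : IsLong p
      · obtain ⟨c, hc⟩ := hp.exists_coloring (A := A)
        exact ⟨c, fun _ => hc⟩
      · exact ⟨fun _ => 0, fun h => absurd h hp⟩
    choose c hc using hcol
    refine ⟨fun x p => if hx : x ∈ Set.range v then c p hx.choose else 0, ?_⟩
    intro x hx y hy hxy hcxy
    have h₁ := congrFun hcxy (pattern hx.choose hy.choose)
    simp only [dif_pos hx, dif_pos hy] at h₁
    refine hc _ (h _ _ ?_) _ _ rfl h₁
    rwa [hx.choose_spec, hy.choose_spec]
  · left
    push Not at h
    obtain ⟨a, b, hab, hp⟩ := h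
    obtain ⟨k, hk⟩ := hasShiftMap_of_not_isLong hEq hAdj e hab hp
    exact hk.exists_injective_hom

end Patterns

/-! ### Cardinal arithmetic -/

section Cardinals

theorem le_reg (κ : Cardinal.{u}) : κ ≤ reg κ := by
  unfold reg
  split_ifs
  · exact Order.le_succ κ
  · exact le_rfl

theorem isRegular_reg {κ : Cardinal.{u}} (hκ : ℵ₀ ≤ κ) : (reg κ).IsRegular := by
  unfold reg
  split_ifs with h
  · exact isRegular_succ hκ
  · by_contra h'
    exact h ⟨hκ, h'⟩

theorem mk_Iio_ord_lt {c : Cardinal.{u}} (i : c.ord.ToType) : #(Set.Iio i) < c := by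
  simpa using mk_Iio_lt i

theorem exists_mk_Iio_eq {c x : Cardinal.{u}} (h : x < c) :
    ∃ i : c.ord.ToType, #(Set.Iio i) = x := by
  have h' : x.ord < Ordinal.type (α := c.ord.ToType) (· < ·) := by
    rw [Ordinal.type_toType]
    exact ord_lt_ord.2 h
  refine ⟨Ordinal.enum (α := c.ord.ToType) (· < ·) ⟨x.ord, h'⟩, ?_⟩
  have := Ordinal.card_typein (r := ((· < ·) : c.ord.ToType → c.ord.ToType → Prop))
    (Ordinal.enum (α := c.ord.ToType) (· < ·) ⟨x.ord, h'⟩)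
  rw [Ordinal.typein_enum, card_ord] at this
  exact this.symm

theorem exists_forall_lt_of_isRegular {c : Cardinal.{u}} (hc : c.IsRegular) {S : Type u}
    (hS : #S < c) (f : S → c.ord.ToType) : ∃ i, ∀ s, f s < i := by
  by_contra! h
  have hcof : IsCofinal (Set.range f) := fun i =>
    let ⟨s, hs⟩ := h i
    ⟨f s, ⟨s, rfl⟩, hs⟩
  have := (Order.cof_le hcof).trans mk_range_le
  rw [Ordinal.cof_toType, hc.cof_ord] at this
  exact absurd hS this.not_gt

theorem self_le_powerlt {θ ρ : Cardinal.{u}} (hρ : ρ.IsRegular) : θ ≤ θ ^< ρ := by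
  simpa using le_powerlt θ (one_lt_aleph0.trans_le hρ.aleph0_le)

theorem powerlt_power_le {θ ρ σ : Cardinal.{u}} (hρ : ρ.IsRegular) (hθ : ρ ≤ θ) (hσ : σ < ρ) :
    (θ ^< ρ) ^ σ ≤ θ ^< ρ := by
  classical
  induction θ using Cardinal.inductionOn with | _ Θ
  induction σ using Cardinal.inductionOn with | _ S
  have hΘ : ℵ₀ ≤ #Θ := hρ.aleph0_le.trans hθ
  obtain ⟨y⟩ : Nonempty Θ := mk_ne_zero_iff.1 (aleph0_pos.trans_le hΘ).ne'
  let T := Σ τ : ρ.ord.ToType, (Set.Iio τ → Θ)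
  let U := Σ τ : ρ.ord.ToType, (S × Set.Iio τ → Θ) × (S → Set.Iio τ)
  have hT : #Θ ^< ρ ≤ #T := by
    refine powerlt_le.2 fun x hx => ?_
    obtain ⟨i, rfl⟩ := exists_mk_Iio_eq hx
    rw [power_def]
    exact mk_le_of_injective (f := fun g => (⟨i, g⟩ : T)) fun g h e => by
      cases e
      rfl
  have hTU : #(S → T) ≤ #U := by
    choose b hb using fun f : S → T =>
      exists_forall_lt_of_isRegular hρ hσ fun s => (f s).1
    let F : (S → T) → U := fun f => ⟨b f,
      fun x => if h : x.2.1 < (f x.1).1 then (f x.1).2 ⟨x.2.1, h⟩ else y,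
      fun s => ⟨(f s).1, hb f s⟩⟩
    refine mk_le_of_injective (f := F) fun f g hfg => ?_
    have key : ∀ (τ τ' : ρ.ord.ToType) (x : (S × Set.Iio τ → Θ) × (S → Set.Iio τ))
        (x' : (S × Set.Iio τ' → Θ) × (S → Set.Iio τ')), (⟨τ, x⟩ : U) = ⟨τ', x'⟩ →
        (∀ s, (x.2 s : ρ.ord.ToType) = x'.2 s) ∧
        ∀ s i (h : i < τ) (h' : i < τ'), x.1 (s, ⟨i, h⟩) = x'.1 (s, ⟨i, h'⟩) := by
      intro τ τ' x x' h
      cases h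
      exact ⟨fun _ => rfl, fun _ _ _ _ => rfl⟩
    obtain ⟨h₁, h₂⟩ := key _ _ _ _ hfg
    funext s
    have e : (f s).1 = (g s).1 := h₁ s
    have h₃ : ∀ i (h : i < (f s).1) (h' : i < (g s).1), (f s).2 ⟨i, h⟩ = (g s).2 ⟨i, h'⟩ := by
      intro i h h'
      have := h₂ s i (h.trans (hb f s)) (h'.trans (hb g s))
      simpa [h, h'] using this
    generalize f s = x at e h₃
    generalize g s = x' at e h₃
    obtain ⟨τ, x⟩ := x
    obtain ⟨τ', x'⟩ := x'
    obtain rfl : τ = τ' := e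
    congr 1
    funext i
    exact h₃ i.1 i.2 i.2
  have hU : #U ≤ #Θ ^< ρ := by
    have hle : ∀ τ : ρ.ord.ToType, #((S × Set.Iio τ → Θ) × (S → Set.Iio τ)) ≤ #Θ ^< ρ := by
      intro τ
      have hτ := mk_Iio_ord_lt τ
      rw [mk_prod, lift_id, lift_id, ← power_def, ← power_def, mk_prod, lift_id, lift_id]
      refine (mul_le_mul_right (power_le_power_right (hτ.le.trans hθ)) _).trans ?_
      rw [← power_add]
      exact le_powerlt _ (add_lt_of_lt hρ.aleph0_le (mul_lt_of_lt hρ.aleph0_le hσ hτ) hσ)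
    rw [mk_sigma]
    refine (sum_le_sum _ _ hle).trans ?_
    rw [sum_const, lift_id, lift_id, mk_ord_toType]
    have h := self_le_powerlt (θ := #Θ) hρ
    exact (mul_le_mul_left (hθ.trans h) _).trans (mul_eq_self (hΘ.trans h)).le
  calc (#Θ ^< ρ) ^ #S ≤ #T ^ #S := power_le_power_right hT
    _ = #(S → T) := (power_def _ _).symm ▸ rfl
    _ ≤ _ := hTU.trans hU

/-- Any partial injection with small domain extends to a permutation. -/
theorem exists_perm_comp_eq {A J : Type u} (hJ : #J < #A) (x y : J → A)
    (hxy : ∀ i j, x i = x j ↔ y i = y j) : ∃ π : Equiv.Perm A, ∀ i, π (x i) = y i := by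
  have hpre : ∀ z : Set.range x, ∃ i, x i = z := fun z => z.2
  choose p hp using hpre
  let f : Set.range x ↪ A := ⟨fun z => y (p z), fun z w h => by
    rw [← hxy, hp, hp] at h
    exact Subtype.ext h⟩
  obtain ⟨π, hπ⟩ := extend_function_of_lt f (mk_range_le.trans_lt hJ) ⟨Equiv.refl A⟩
  refine ⟨π, fun i => (hπ ⟨x i, i, rfl⟩).trans ?_⟩
  exact (hxy _ _).1 (hp _)

end Cardinals

/-! ### Terms -/

namespace FreeAlg

variable {μ κ : Cardinal.{u}} {X Y A : Type u}

theorem map_map (f : X → Y) (g : Y → A) (t : FreeAlg μ κ X) :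
    map g (map f t) = map (g ∘ f) t := by
  induction t with
  | of x => rfl
  | app α β b ih => simp only [map, ih]

theorem map_injective {f : X → Y} (hf : Function.Injective f) :
    Function.Injective (map f : FreeAlg μ κ X → FreeAlg μ κ Y) := by
  intro s
  induction s with
  | of x =>
    intro t h
    cases t with
    | of y =>
      simp only [map, of.injEq] at h
      rw [hf h]
    | app => simp [map] at h
  | app α β b ih =>
    intro t h
    cases t with
    | of y => simp [map] at h
    | app α' β' b' =>
      simp only [map, app.injEq] at h
      obtain ⟨rfl, rfl, h⟩ := h
      congr 1
      funext i
      exact ih i (congrFun (eq_of_heq h) i)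

/-- The set of generators occurring in an element of the free algebra. -/
def supp : FreeAlg μ κ A → Set A
  | .of a => {a}
  | .app _ _ b => ⋃ i, supp (b i)

theorem mk_supp_lt {ρ : Cardinal.{u}} (hρ : ρ.IsRegular) (hκ : κ ≤ ρ) (t : FreeAlg μ κ A) :
    #t.supp < ρ := by
  induction t with
  | of a =>
    simp only [supp, mk_singleton]
    exact one_lt_aleph0.trans_le hρ.aleph0_le
  | app α β b ih =>
    simp only [supp]
    rw [card_iUnion_lt_iff_forall_of_isRegular hρ ((mk_Iio_ord_lt β).trans_le hκ)]
    exact ih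

theorem exists_map_eq {f : X → A} (t : FreeAlg μ κ A) (ht : t.supp ⊆ Set.range f) :
    ∃ s, map f s = t := by
  induction t with
  | of a =>
    obtain ⟨x, hx⟩ := ht rfl
    exact ⟨.of x, by simp only [map, hx]⟩
  | app α β b ih =>
    choose s hs using fun i => ih i ((Set.subset_iUnion _ i).trans ht)
    exact ⟨.app α β s, by simp only [map, hs]⟩

theorem mk_le {ρ : Cardinal.{u}} (hρ : ρ.IsRegular) (hκ : κ ≤ ρ)
    (hX : #X ≤ (ρ + μ) ^< ρ) : #(FreeAlg μ κ X) ≤ (ρ + μ) ^< ρ := by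
  let ar : X ⊕ (μ.ord.ToType × κ.ord.ToType) → Type u :=
    Sum.elim (fun _ => PEmpty) fun x => Set.Iio x.2
  let F : WType ar → FreeAlg μ κ X := WType.elim _ fun x =>
    match x with
    | ⟨.inl x, _⟩ => .of x
    | ⟨.inr (α, β), b⟩ => .app α β b
  have hF : Function.Surjective F := by
    intro t
    induction t with
    | of x => exact ⟨⟨.inl x, PEmpty.elim⟩, rfl⟩
    | app α β b ih =>
      choose w hw using ih
      refine ⟨⟨.inr (α, β), w⟩, ?_⟩
      have : F ⟨.inr (α, β), w⟩ = .app α β fun i => F (w i) := rfl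
      rw [this]
      simp only [hw]
  have hself := self_le_powerlt (θ := ρ + μ) hρ
  have hρle : ρ ≤ (ρ + μ) ^< ρ := (self_le_add_right ρ μ).trans hself
  have hinf : ℵ₀ ≤ (ρ + μ) ^< ρ := hρ.aleph0_le.trans hρle
  refine (mk_le_of_surjective hF).trans (WType.cardinalMk_le_of_le' ?_)
  refine (sum_le_sum _ (fun _ => (ρ + μ) ^< ρ) ?_).trans ?_
  · rintro (x | ⟨α, β⟩)
    · simpa [ar] using one_le_aleph0.trans hinf
    · simpa [ar] using powerlt_power_le hρ (self_le_add_right ρ μ)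
        ((mk_Iio_ord_lt β).trans_le hκ)
  · rw [sum_const, lift_id, lift_id]
    refine mul_le_of_le hinf ?_ le_rfl
    rw [mk_sum, mk_prod]
    simp only [lift_id, mk_ord_toType]
    exact add_le_of_le hinf hX
      (mul_le_of_le hinf ((self_le_add_left μ ρ).trans hself) (hκ.trans hρle))

end FreeAlg

/-! ### Types and definable closure -/

section ModelTheory

open FirstOrder FirstOrder.Language

variable {L : FirstOrder.Language.{u₁, u₂}} {M : Type u} [L.Structure M]
  {μ κ : Cardinal.{u}} {A : Type u} {D : Set M} {Φ : D → FreeAlg μ κ A}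

theorem IsSkeletalHomRep.sameType (hΦ : IsSkeletalHomRep L D Φ) {ι : Type} [Finite ι]
    {a b : ι → D} (π : Equiv.Perm A) (h : ∀ i, FreeAlg.map π (Φ (a i)) = Φ (b i)) :
    SameType L (fun i => (a i : M)) (fun i => (b i : M)) := by
  obtain ⟨n, ⟨e⟩⟩ := Finite.exists_equiv_fin (Set.range a)
  choose p hp using fun z : Set.range a => z.2
  have ha : Function.Injective fun k => a (p (e.symm k)) := by
    intro k l hkl
    simp only [hp] at hkl
    exact e.symm.injective (Subtype.ext hkl)
  have hb : Function.Injective fun k => b (p (e.symm k)) := by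
    intro k l hkl
    apply ha
    apply hΦ.injective
    apply FreeAlg.map_injective π.injective
    simp only [h]
    exact congrArg Φ hkl
  have key := hΦ.type_homogeneous n _ _ ha hb ⟨π, fun k => h _⟩
  let c : ι → Fin n := fun i => e ⟨a i, i, rfl⟩
  have hac : ∀ i, a (p (e.symm (c i))) = a i := fun i => by
    simp only [c, Equiv.symm_apply_apply, hp]
  have hbc : ∀ i, b (p (e.symm (c i))) = b i := fun i => by
    apply hΦ.injective
    rw [← h, ← h, hac]
  intro φ
  have := key (φ.relabel c)
  simp only [Formula.realize_relabel, Function.comp_def, hac, hbc] at this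
  exact this

theorem SameType.exists_realize {ι γ : Type} [Finite γ] {a b : ι → M} (h : SameType L a b)
    (φ : L.Formula (ι ⊕ γ)) (ha : ∃ z, φ.Realize (Sum.elim a z)) :
    ∃ z, φ.Realize (Sum.elim b z) := by
  rw [← Formula.realize_iExs] at ha ⊢
  exact (h _).1 ha

theorem exists_formula_of_dcl_eq_univ (hD : dcl L D = Set.univ) {r : ℕ} (x : Fin r → M) :
    ∃ (N : ℕ) (ψ : L.Formula (Fin N ⊕ Fin r)) (d : Fin N → D),
      {x} = {w | ψ.Realize (Sum.elim (fun i => (d i : M)) w)} := by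
  classical
  have hx : D.Definable L {x} := by
    have h₁ : ∀ i : Fin r, D.Definable L {w : Fin r → M | w i = x i} := by
      intro i
      have h : x i ∈ dcl L D := hD ▸ Set.mem_univ _
      exact Set.Definable.preimage_comp (fun _ : Fin 1 => i) h
    have h₂ := Set.definable_iInter_of_finite h₁
    convert h₂ using 1
    ext w
    simp [funext_iff]
  obtain ⟨φ, hφ⟩ := Set.definable_iff_exists_formula_sum.1 hx
  let E : Finset D := φ.freeVarFinset.toLeft
  let f : φ.freeVarFinset → Fin E.card ⊕ Fin r := fun y =>
    match y with
    | ⟨.inl y, h⟩ => .inl (E.equivFin ⟨y, Finset.mem_toLeft.2 h⟩)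
    | ⟨.inr i, _⟩ => .inr i
  refine ⟨E.card, φ.restrictFreeVar f, fun i => (E.equivFin.symm i : D), ?_⟩
  rw [hφ]
  ext w
  refine (BoundedFormula.realize_restrictFreeVar _ ?_).symm
  rintro ⟨y | i, h⟩ <;> simp [f]

theorem exists_terms (hκ : ℵ₀ ≤ κ) {N : ℕ} (y : Fin N → FreeAlg μ κ A) :
    ∃ (β : (reg κ).ord.ToType) (a : Set.Iio β ↪ A) (τ : Fin N → FreeAlg μ κ (Set.Iio β)),
      ∀ i, FreeAlg.map a (τ i) = y i := by
  have hρ := isRegular_reg hκ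
  let S : Set A := ⋃ i : ULift.{u} (Fin N), (y i.down).supp
  have hS : #S < reg κ := by
    rw [card_iUnion_lt_iff_forall_of_isRegular hρ]
    · exact fun i => FreeAlg.mk_supp_lt hρ (le_reg κ) _
    · exact (lt_aleph0_of_finite _).trans_le hρ.aleph0_le
  obtain ⟨β, hβ⟩ := exists_mk_Iio_eq hS
  obtain ⟨e⟩ := Cardinal.eq.1 hβ
  let a : Set.Iio β ↪ A := e.toEmbedding.trans (Function.Embedding.subtype _)
  have ha : ∀ i, (y i).supp ⊆ Set.range a := fun i z hz =>
    ⟨e.symm ⟨z, Set.mem_iUnion.2 ⟨⟨i⟩, hz⟩⟩, by simp [a]⟩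
  choose τ hτ using fun i => FreeAlg.exists_map_eq (y i) (ha i)
  exact ⟨β, a, τ, hτ⟩

/-- The point `x` is the solution of `ψ` over a tuple of `D` that is represented by the terms `τ`
evaluated at `a`. -/
def IsRepresentedBy (Φ : D → FreeAlg μ κ A) {N r : ℕ} (ψ : L.Formula (Fin N ⊕ Fin r))
    {β : (reg κ).ord.ToType} (τ : Fin N → FreeAlg μ κ (Set.Iio β)) (a : Set.Iio β ↪ A)
    (x : Fin r → M) : Prop :=
  ∃ d : Fin N → D, (∀ i, FreeAlg.map a (τ i) = Φ (d i)) ∧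
    {x} = {w | ψ.Realize (Sum.elim (fun i => (d i : M)) w)}

theorem IsSkeletalHomRep.exists_isRepresentedBy (hΦ : IsSkeletalHomRep L D Φ) (hκ : ℵ₀ ≤ κ)
    {r : ℕ} (x : Fin r → M) :
    ∃ (N : ℕ) (ψ : L.Formula (Fin N ⊕ Fin r)) (β : (reg κ).ord.ToType)
      (τ : Fin N → FreeAlg μ κ (Set.Iio β)) (a : Set.Iio β ↪ A), IsRepresentedBy Φ ψ τ a x := by
  obtain ⟨N, ψ, d, hd⟩ := exists_formula_of_dcl_eq_univ hΦ.dcl_eq x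
  obtain ⟨β, a, τ, h⟩ := exists_terms hκ fun i => Φ (d i)
  exact ⟨N, ψ, β, τ, a, d, h, hd⟩

/-- The vertices of an interpretable graph that are represented by a fixed formula and fixed terms
are given by a map on injective tuples for which equality and adjacency only depend on equality
patterns. -/
theorem IsSkeletalHomRep.exists_patternInvariant (hΦ : IsSkeletalHomRep L D Φ) (hA : ℵ₀ ≤ #A)
    {V : Type u} {G : SimpleGraph V} {r : ℕ} {V₀ : Set (Fin r → M)} {g : V₀ → V}
    (hV₀ : (∅ : Set M).Definable L V₀)
    (hEq : (∅ : Set M).Definable L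
      {p : Fin r ⊕ Fin r → M | ∃ x y : V₀, p = Sum.elim x.1 y.1 ∧ g x = g y})
    (hAdj : (∅ : Set M).Definable L
      {p : Fin r ⊕ Fin r → M | ∃ x y : V₀, p = Sum.elim x.1 y.1 ∧ G.Adj (g x) (g y)})
    {N : ℕ} {ψ : L.Formula (Fin N ⊕ Fin r)} {β : (reg κ).ord.ToType} (hβ : #(Set.Iio β) < #A)
    {τ : Fin N → FreeAlg μ κ (Set.Iio β)} {a₀ : Set.Iio β ↪ A} {x₀ : V₀}
    (h₀ : IsRepresentedBy Φ ψ τ a₀ x₀.1) :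
    ∃ v : (Set.Iio β ↪ A) → V, PatternInvariant v Eq ∧ PatternInvariant v G.Adj ∧
      ∀ a (x : V₀), IsRepresentedBy Φ ψ τ a x.1 → v a = g x := by
  obtain ⟨d₀, hd₀, hx₀⟩ := h₀
  have hd : ∀ (a : Set.Iio β ↪ A) i, ∃ y, Φ y = FreeAlg.map a (τ i) := fun a i =>
    hΦ.image_homogeneous β (τ i) a₀ a a₀.injective a.injective ⟨d₀ i, (hd₀ i).symm⟩
  choose d hd using hd
  have hd_unique : ∀ (a : Set.Iio β ↪ A) (d' : Fin N → D),
      (∀ i, FreeAlg.map a (τ i) = Φ (d' i)) → d' = d a := by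
    intro a d' h
    funext i
    apply hΦ.injective
    rw [hd, h]
  let Sol : (Set.Iio β ↪ A) → (Fin r → M) → Prop := fun a w =>
    ψ.Realize (Sum.elim (fun i => (d a i : M)) w)
  have transfer : ∀ {S : Set (Fin r ⊕ Fin r → M)}, (∅ : Set M).Definable L S →
      ∀ {a b a' b'}, pattern a b = pattern a' b' →
      (∃ z ∈ S, Sol a (z ∘ Sum.inl) ∧ Sol b (z ∘ Sum.inr)) →
      ∃ z ∈ S, Sol a' (z ∘ Sum.inl) ∧ Sol b' (z ∘ Sum.inr) := by
    intro S hS a b a' b' hp hz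
    obtain ⟨θ, rfl⟩ := Set.empty_definable_iff.1 hS
    have hpat : ∀ i j, a i = b j ↔ a' i = b' j := fun i j => iff_of_eq (congrFun₂ hp i j)
    have hpat' : ∀ i j, b i = a j ↔ b' i = a' j := fun i j => by
      rw [eq_comm, hpat, eq_comm]
    obtain ⟨π, hπ⟩ := exists_perm_comp_eq (J := Set.Iio β ⊕ Set.Iio β)
      (by simpa using add_lt_of_lt hA hβ hβ) (Sum.elim a b) (Sum.elim a' b')
      (by rintro (i | i) (j | j) <;> simp [hpat, hpat'])
    have hπa : π ∘ a = a' := funext fun i => hπ (.inl i)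
    have hπb : π ∘ b = b' := funext fun i => hπ (.inr i)
    have hst := hΦ.sameType (a := Sum.elim (d a) (d b)) (b := Sum.elim (d a') (d b')) π (by
      rintro (i | i)
      · simp only [Sum.elim_inl, hd, FreeAlg.map_map, hπa]
      · simp only [Sum.elim_inr, hd, FreeAlg.map_map, hπb])
    let χ : L.Formula ((Fin N ⊕ Fin N) ⊕ (Fin r ⊕ Fin r)) :=
      θ.relabel Sum.inr ⊓ (ψ.relabel (Sum.map Sum.inl Sum.inl) ⊓
        ψ.relabel (Sum.map Sum.inr Sum.inr))
    have hχ : ∀ (a b : Set.Iio β ↪ A) z,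
        χ.Realize (Sum.elim (fun i => ((Sum.elim (d a) (d b) i : D) : M)) z) ↔
        z ∈ Set.ofPred θ.Realize ∧ Sol a (z ∘ Sum.inl) ∧ Sol b (z ∘ Sum.inr) := by
      intro a b z
      simp only [χ, Formula.realize_inf, Formula.realize_relabel, Sol, Sum.elim_comp_map,
        Sum.elim_comp_inr]
      rfl
    obtain ⟨z, hz⟩ := hz
    obtain ⟨z', hz'⟩ := hst.exists_realize χ ⟨z, (hχ a b z).2 hz⟩
    exact ⟨z', (hχ a' b' z').1 hz'⟩
  have hself : ∀ a b : Set.Iio β ↪ A, pattern a a = pattern b b := fun a b => by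
    funext i j
    simp [pattern]
  have hSol₀ : ∀ w, Sol a₀ w ↔ w = x₀.1 := by
    intro w
    rw [hd_unique a₀ d₀ hd₀] at hx₀
    exact (Set.ext_iff.1 hx₀ w).symm
  have hinl : (∅ : Set M).Definable L {z : Fin r ⊕ Fin r → M | z ∘ Sum.inl ∈ V₀} :=
    hV₀.preimage_comp Sum.inl
  have hinr : (∅ : Set M).Definable L {z : Fin r ⊕ Fin r → M | z ∘ Sum.inr ∈ V₀} :=
    hV₀.preimage_comp Sum.inr
  have hex : ∀ a, ∃ x : V₀, Sol a x.1 := by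
    intro a
    obtain ⟨z, hz, h, -⟩ := transfer hinl (hself a₀ a)
      ⟨Sum.elim x₀.1 x₀.1, by simp, by simp [hSol₀], by simp [hSol₀]⟩
    exact ⟨⟨_, hz⟩, h⟩
  have huniq : ∀ a (x y : V₀), Sol a x.1 → Sol a y.1 → g x = g y := by
    intro a x y hx hy
    by_contra hne
    obtain ⟨z, ⟨⟨hz₁, hz₂⟩, hz₃⟩, h₁, h₂⟩ := transfer ((hinl.inter hinr).inter hEq.compl)
      (hself a a₀) ⟨Sum.elim x.1 y.1, ⟨⟨by simp, by simp⟩, by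
        rintro ⟨x', y', h, h'⟩
        have e₁ : x = x' := Subtype.ext (by simpa using congrArg (· ∘ Sum.inl) h)
        have e₂ : y = y' := Subtype.ext (by simpa using congrArg (· ∘ Sum.inr) h)
        exact hne (e₁ ▸ e₂ ▸ h')⟩, by simpa using hx, by simpa using hy⟩
    rw [hSol₀] at h₁ h₂
    refine hz₃ ⟨x₀, x₀, ?_, rfl⟩
    rw [← Sum.elim_comp_inl_inr z, h₁, h₂]
  choose x hx using hex
  have hinv : ∀ R : V → V → Prop, (∅ : Set M).Definable L
      {p : Fin r ⊕ Fin r → M | ∃ x y : V₀, p = Sum.elim x.1 y.1 ∧ R (g x) (g y)} →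
      PatternInvariant (fun a => g (x a)) R := by
    intro R hR a b a' b' hp hab
    obtain ⟨z, ⟨y, y', rfl, hyy'⟩, h₁, h₂⟩ := transfer hR hp
      ⟨Sum.elim (x a).1 (x b).1, ⟨x a, x b, rfl, hab⟩, by simpa using hx a, by simpa using hx b⟩
    rw [Sum.elim_comp_inl] at h₁
    rw [Sum.elim_comp_inr] at h₂
    beta_reduce
    rwa [huniq a' _ _ (hx a') h₁, huniq b' _ _ (hx b') h₂]
  refine ⟨fun a => g (x a), hinv _ hEq, hinv _ hAdj, ?_⟩
  rintro a y ⟨d', hd', hy⟩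
  refine huniq a _ _ (hx a) ?_
  rw [hd_unique a d' hd'] at hy
  exact (Set.ext_iff.1 hy y.1).1 rfl

end ModelTheory

/-! ### Counting colours -/

theorem chromaticCard_lt_of_fibers {V W : Type u} {G : SimpleGraph V} {ϰ : Cardinal.{u}}
    (hϰ : ϰ.IsRegular) (hW : #W < ϰ) (p : V → W) (C : W → Type u) (hC : ∀ w, #(C w) < ϰ)
    (c : ∀ w, V → C w) (hc : ∀ w x y, p x = w → p y = w → G.Adj x y → c w x ≠ c w y) :
    chromaticCard G < ϰ := by
  refine lt_of_le_of_lt ?_ (sum_lt_of_isRegular hϰ hW hC)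
  rw [← mk_sigma]
  refine csInf_le' ⟨_, rfl, ⟨SimpleGraph.Coloring.mk (fun x => ⟨p x, c (p x) x⟩) ?_⟩⟩
  intro x y hxy h
  have e : p x = p y := congrArg Sigma.fst h
  have key : ∀ w w' (z : C w) (z' : ∀ w, C w), (⟨w, z⟩ : Σ w, C w) = ⟨w', z' w'⟩ → z = z' w := by
    intro w w' z z' h
    cases h
    rfl
  exact hc (p x) x y rfl e.symm hxy (key _ _ _ (fun w => c w y) h)

theorem mk_pattern_colors_lt {B : Type u} {ϰ : Cardinal.{u}} (h₀ : ℵ₀ < ϰ)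
    (hB : (2 : Cardinal.{u}) ^ ((2 : Cardinal.{u}) ^ #B) < ϰ) :
    #((B → B → Prop) → ℕ × ℕ) < ϰ := by
  rcases finite_or_infinite B with hfin | hinf
  · exact mk_le_aleph0.trans_lt h₀
  · have hB' : ℵ₀ ≤ #B := aleph0_le_mk B
    have h₁ : #(B → B → Prop) = 2 ^ #B := by
      have : #(B → B → Prop) = (2 ^ #B) ^ #B := by simp
      rw [this, ← power_mul, mul_eq_self hB']
    have h₂ : #((B → B → Prop) → ℕ × ℕ) = ℵ₀ ^ (#(B → B → Prop)) := by simp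
    rw [h₂, h₁]
    refine lt_of_le_of_lt ?_ hB
    have h₃ : ℵ₀ ≤ (2 : Cardinal.{u}) ^ #B := hB'.trans (cantor _).le
    exact (power_eq_two_power h₃ (by exact_mod_cast (natCast_lt_aleph0 (n := 2)).le) h₃).le

theorem lift_mk_formulas_lt {L : FirstOrder.Language.{u₁, u₂}} {ϰ : Cardinal.{u}} (h₀ : ℵ₀ < ϰ)
    (hL : Cardinal.lift.{u} L.card < Cardinal.lift.{max u₁ u₂} ϰ) (r : ℕ) :
    Cardinal.lift.{u} #(Σ N : ℕ, L.Formula (Fin N ⊕ Fin r)) < Cardinal.lift.{max u₁ u₂} ϰ := by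
  have h : ∀ N : ℕ, #(L.Formula (Fin N ⊕ Fin r)) ≤ max ℵ₀ L.card := by
    intro N
    have h₁ : #(L.Formula (Fin N ⊕ Fin r)) ≤ #(Σ n, L.BoundedFormula (Fin N ⊕ Fin r) n) :=
      mk_le_of_injective (f := fun φ => ⟨0, φ⟩) fun φ ψ h => by
        cases h
        rfl
    refine (h₁.trans FirstOrder.Language.BoundedFormula.card_le).trans ?_
    refine max_le (le_max_left _ _) (add_le_of_le (le_max_left _ _) ?_ ?_)
    · refine le_trans ?_ (le_max_left _ _)
      rw [lift_le_aleph0]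
      exact mk_le_aleph0
    · rw [lift_id'.{0, max u₁ u₂}]
      exact le_max_right _ _
  have h' : #(Σ N : ℕ, L.Formula (Fin N ⊕ Fin r)) ≤ max ℵ₀ L.card := by
    rw [mk_sigma]
    refine (sum_le_sum _ _ h).trans ?_
    rw [sum_const]
    refine mul_le_of_le (le_max_left _ _) ?_ ?_
    · simp
    · simp
  refine (lift_le.2 h').trans_lt ?_
  rw [lift_max, lift_aleph0, max_lt_iff]
  exact ⟨aleph0_lt_lift.2 h₀, hL⟩

theorem mk_terms_lt {μ κ ϰ : Cardinal.{u}} (hκ : ℵ₀ ≤ κ) (hϰ : ϰ.IsRegular)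
    (h₁ : (reg κ + μ) ^< reg κ < ϰ) :
    #(Σ (N : ℕ) (β : (reg κ).ord.ToType), Fin N → FreeAlg μ κ (Set.Iio β)) < ϰ := by
  have hρ := isRegular_reg hκ
  have hρle : reg κ ≤ (reg κ + μ) ^< reg κ :=
    (self_le_add_right _ _).trans (self_le_powerlt hρ)
  have h₀ : ℵ₀ < ϰ := (hρ.aleph0_le.trans hρle).trans_lt h₁
  rw [mk_sigma]
  refine sum_lt_lift_of_isRegular hϰ (by simpa using h₀) fun N => ?_
  rw [mk_sigma]
  refine sum_lt_of_isRegular hϰ (by simpa using hρle.trans_lt h₁) fun β => ?_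
  have : #(FreeAlg μ κ (Set.Iio β)) < ϰ :=
    (FreeAlg.mk_le hρ (le_reg κ) ((mk_Iio_ord_lt β).le.trans hρle)).trans_lt h₁
  simpa using power_nat_le_max.trans_lt (max_lt this h₀)

end ShiftRep

theorem propositionP (L : FirstOrder.Language.{u₁, u₂}) (M : Type u) [L.Structure M]
    (A : Type u) (μ κ ϰ : Cardinal.{u})
    (hμ : Cardinal.aleph0 ≤ μ) (hκ : Cardinal.aleph0 ≤ κ) (hϰ : ϰ.IsRegular)
    (hL : Cardinal.lift.{u} L.card < Cardinal.lift.{max u₁ u₂} ϰ)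
    (D : Set M) (Φ : D → ShiftRep.FreeAlg μ κ A) (hΦ : ShiftRep.IsSkeletalHomRep L D Φ)
    (h₁ : Cardinal.powerlt (ShiftRep.reg κ + μ) (ShiftRep.reg κ) < ϰ)
    (h₂ : ∀ l < ShiftRep.reg κ, (2 : Cardinal.{u}) ^ ((2 : Cardinal.{u}) ^ l) < ϰ)
    (h₃ : Cardinal.powerlt 2 (ShiftRep.reg κ) ≤ Cardinal.mk A)
    (V : Type u) (G : SimpleGraph V) (hG : ShiftRep.IsInterpretable L M G)
    (hχ : ϰ ≤ ShiftRep.chromaticCard G) :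
    ∃ n : ℕ, 1 ≤ n ∧
      ShiftRep.ContainsFiniteSubgraphs (ShiftRep.shiftGraph n ℕ) G := by
  open ShiftRep in
  classical
  obtain ⟨r, V₀, g, hV₀, hg, hEq, hAdj⟩ := hG
  have hρ := isRegular_reg hκ
  have hρle : reg κ ≤ (reg κ + μ) ^< reg κ :=
    (self_le_add_right _ _).trans (self_le_powerlt hρ)
  have h₀ : ℵ₀ < ϰ := (hρ.aleph0_le.trans hρle).trans_lt h₁
  have hlt : ∀ l < reg κ, l < #A := fun l hl =>
    (cantor l).trans_le ((le_powerlt 2 hl).trans h₃)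
  have hA : ℵ₀ ≤ #A := le_of_forall_lt fun l hl => hlt l (hl.trans_le hρ.aleph0_le)
  by_contra hcon
  have hno : ¬ ∃ n : ℕ, 1 ≤ n ∧ ∃ f : shiftGraph n ℕ →g G, Function.Injective f := by
    rintro ⟨n, hn, f, hf⟩
    exact hcon ⟨n, hn, fun S _ => ⟨(f.comp S.hom).toCopy (hf.comp Subtype.val_injective)⟩⟩
  have hrep : ∀ v : V, ∃ (x : V₀) (N : ℕ) (ψ : L.Formula (Fin N ⊕ Fin r))
      (β : (reg κ).ord.ToType) (τ : Fin N → FreeAlg μ κ (Set.Iio β)) (a : Set.Iio β ↪ A),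
      g x = v ∧ IsRepresentedBy Φ ψ τ a x.1 := by
    intro v
    obtain ⟨x, hx⟩ := hg v
    obtain ⟨N, ψ, β, τ, a, h⟩ := hΦ.exists_isRepresentedBy hκ x.1
    exact ⟨x, N, ψ, β, τ, a, hx, h⟩
  choose x N ψ β τ a hx hr using hrep
  let F := Σ N : ℕ, L.Formula (Fin N ⊕ Fin r)
  let T := Σ (N : ℕ) (β : (reg κ).ord.ToType), Fin N → FreeAlg μ κ (Set.Iio β)
  let cl : V → F × T := fun v => (⟨N v, ψ v⟩, ⟨N v, β v, τ v⟩)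
  let W := Quotient (Setoid.ker cl)
  have hW : #W < ϰ := by
    have hinj : Function.Injective (Setoid.kerLift cl) := Setoid.kerLift_injective cl
    have hle := lift_mk_le_lift_mk_of_injective hinj
    rw [lift_id'.{u, max u₁ u₂}, lift_umax.{u, max u₁ u₂}] at hle
    rw [← lift_lt.{u, max u₁ u₂}]
    refine hle.trans_lt ?_
    have hF := lift_mk_formulas_lt h₀ hL r
    have hT := lift_lt.{u, max u₁ u₂}.2 (mk_terms_lt (μ := μ) hκ hϰ h₁)
    have := mul_lt_of_lt (by simpa using h₀.le) hF hT
    rwa [← mk_prod] at this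
  have hcol : ∀ w : W, ∃ c : V → ((Set.Iio (β w.out) → Set.Iio (β w.out) → Prop) → ℕ × ℕ),
      ∀ v v' : V, (Quotient.mk _ v : W) = w → (Quotient.mk _ v' : W) = w → G.Adj v v' →
        c v ≠ c v' := by
    intro w
    set v₀ := w.out
    have hβ := hlt _ (mk_Iio_ord_lt (β v₀))
    obtain ⟨f, hfEq, hfAdj, hf⟩ :=
      hΦ.exists_patternInvariant hA hV₀ hEq hAdj hβ (hr v₀)
    have hemb : Nonempty (Set.Iio (β v₀) × Option ℕ ↪ A) := by
      rw [← Cardinal.le_def]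
      simpa using mul_le_of_le hA hβ.le hA
    obtain ⟨e⟩ := hemb
    rcases exists_injective_hom_or_coloring hfEq hfAdj e with h | ⟨c, hc⟩
    · exact absurd h hno
    have hmem : ∀ v : V, (Quotient.mk _ v : W) = w → v ∈ Set.range f := by
      intro v hv
      have hcl : cl v = cl v₀ := by
        rw [← Quotient.out_eq w] at hv
        exact Quotient.exact hv
      have key : ∀ (N N' : ℕ) (ψ : L.Formula (Fin N ⊕ Fin r)) (ψ' : L.Formula (Fin N' ⊕ Fin r))
          (β β' : (reg κ).ord.ToType) (τ : Fin N → FreeAlg μ κ (Set.Iio β))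
          (τ' : Fin N' → FreeAlg μ κ (Set.Iio β')) (a : Set.Iio β ↪ A) (x : Fin r → M),
          (⟨N, ψ⟩ : F) = ⟨N', ψ'⟩ → (⟨N, β, τ⟩ : T) = ⟨N', β', τ'⟩ →
          IsRepresentedBy Φ ψ τ a x → ∃ a', IsRepresentedBy Φ ψ' τ' a' x := by
        intro N N' ψ ψ' β β' τ τ' a x e₁ e₂ h
        cases e₁
        cases e₂
        exact ⟨a, h⟩
      obtain ⟨a', ha'⟩ := key _ _ _ _ _ _ _ _ _ _ (congrArg Prod.fst hcl)
        (congrArg Prod.snd hcl) (hr v)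
      exact ⟨a', (hf a' (x v) ha').trans (hx v)⟩
    exact ⟨c, fun v v' hv hv' => hc v (hmem v hv) v' (hmem v' hv')⟩
  choose c hc using hcol
  refine absurd hχ (not_le.2 (chromaticCard_lt_of_fibers hϰ hW (Quotient.mk _) _ ?_ c hc))
  exact fun w => mk_pattern_colors_lt h₀ (h₂ _ (mk_Iio_ord_lt _))
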